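/- Consider on $\mathbb{R}^d$ the Cauchy problem $$ i\partial_t u+\Delta u+\eta u=0,\qquad u(0)=u_0, \tag{1} $$ with a complex-valued potential $\eta=\eta(x)$. *Solutions.* Let $\gamma\in\mathbb{R}$, $T\in(0,\infty]$. A strong solution of (1) on $[0,T)$ is a function $u\in C([0,T);H^\gamma(\mathbb{R}^d))$ with $u(0)=u_0$ for which there are tempered distributions $w(s)$ with $w(s)=\eta u(s)$ for a.e. $s\in(0,T)$ and $$u(t)=u_0+i\int_0^t\big(\Delta u(s)+w(s)\big)\,ds\qquad(0\le t<T)$$ when tested against every Schwartz function (with $s\mapsto\langle w(s),\varphi\rangle$ integrable on $[0,t]$). Here "$w=\eta v$" for tempered distributions $v,w$ means: on every open set on which $\eta$ agrees a.e. with a smooth function, $w$ is the product of that smooth function and $v$; and on every open set on which $v$ is a locally integrable function with $\eta v$ locally integrable, $w$ is the function $\eta v$. *Well-posedness.* (1) is locally well-posed in $H^\gamma$ if there are auxiliary classes $X_T$ of functions on $[0,T)$, lifespans $T_{\max}(u_0)\in(0,\infty]$ and a solution map $u_0\mapsto\Phi(u_0)$ such that (i) for every $u_0\in H^\gamma$,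 $\Phi(u_0)$ is a strong solution on $[0,T_{\max}(u_0))$ in the auxiliary class; (ii) every strong solution $u\in X_T$ on some $[0,T)$ with data $u_0\in H^\gamma$ satisfies $T\le T_{\max}(u_0)$ and $u=\Phi(u_0)$ on $[0,T)$; (iii) for each $t$ the map $u_0\mapsto\Phi(u_0)(t)$, defined on the data with $t<T_{\max}(u_0)$, is continuous from $H^\gamma$ to $H^\gamma$. Otherwise (1) is ill-posed in $H^\gamma$. **Theorem 1.2.** Let $d\ge 3$ and $1\le r<\frac d2$. There is $\eta\in L^r(\mathbb{R}^d)+L^\infty(\mathbb{R}^d)$ such that for every $\gamma\in\mathbb{R}$ the problem (1) is ill-posed in $H^\gamma(\mathbb{R}^d)$. Moreover, continuous dependence on the data fails at the zero solution: for every $\gamma\in\mathbb{R}$ there are Schwartz data $f_n\to0$ in $H^\gamma$ such that for all $T\in(0,\infty]$ and $C<\infty$, for all sufficiently large $n$, every strong solution $u$ of (1) on $[0,T)$ with $u(0)=f_n$ satisfies $\sup_{0\le t<T}\|u(t)\|_{H^\gamma}>C$. -/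

import Mathlib

open MeasureTheory Filter TemperedDistribution
open scoped SchwartzMap ENNReal Topology Laplacian

/-- `η ∈ L^r + L^∞` on `ℝ^d`. -/
def MemLrAddLinfty {d : ℕ} (r : ℝ) (η : EuclideanSpace ℝ (Fin d) → ℂ) : Prop :=
  ∃ η₁ η₂ : EuclideanSpace ℝ (Fin d) → ℂ,
    MemLp η₁ (ENNReal.ofReal r) volume ∧ MemLp η₂ ∞ volume ∧ η = η₁ + η₂

/-- The norm of `H^γ(ℝ^d)` on tempered distributions: the `L²` norm of the Bessel potential of
order `γ`, and `∞` for a distribution outside `H^γ` (the infimum is over at most one element).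
With Mathlib's normalization of the Fourier transform this is the norm
`‖(1 - (2π)⁻² Δ)^(γ/2) v‖`, which is equivalent to `‖(1 - Δ)^(γ/2) v‖`. -/
noncomputable def sobolevNorm {d : ℕ} (γ : ℝ) (v : 𝓢'(EuclideanSpace ℝ (Fin d), ℂ)) : ℝ≥0∞ :=
  ⨅ (f : Lp ℂ 2 (volume : Measure (EuclideanSpace ℝ (Fin d))))
    (_ : besselPotential (EuclideanSpace ℝ (Fin d)) ℂ γ v = f), ‖f‖ₑ

/-- The time interval `[0, T)`, for `T ∈ [0, ∞]`. -/
def timeInterval (T : ℝ≥0∞) : Set ℝ := {t | 0 ≤ t ∧ ENNReal.ofReal t < T}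

/-- `w = η v` as tempered distributions, for a function `η` and a tempered distribution `v`. Since
`v` may be rough, the product is specified locally, wherever it has a classical meaning:
* on an open set where `η` is smooth it is the product of a smooth function and a distribution;
* on an open set where `v` is a locally integrable function `g` such that `η g` is locally
  integrable, it is the function `η g`.

Nothing else is required of `w`, so that every customary reading of `η v` is covered. -/
structure IsPotentialMul {d : ℕ} (η : EuclideanSpace ℝ (Fin d) → ℂ)
    (v w : 𝓢'(EuclideanSpace ℝ (Fin d), ℂ)) : Prop where
  smooth : ∀ (U : Set (EuclideanSpace ℝ (Fin d))) (h : EuclideanSpace ℝ (Fin d) → ℂ),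
    IsOpen U → h.HasTemperateGrowth → (∀ᵐ x ∂volume.restrict U, η x = h x) →
    ∀ φ : 𝓢(EuclideanSpace ℝ (Fin d), ℂ), HasCompactSupport φ → tsupport φ ⊆ U →
      w φ = v (SchwartzMap.smulLeftCLM ℂ h φ)
  pointwise : ∀ (U : Set (EuclideanSpace ℝ (Fin d))) (g : EuclideanSpace ℝ (Fin d) → ℂ),
    IsOpen U → LocallyIntegrableOn g U volume →
    LocallyIntegrableOn (fun x => η x * g x) U volume →
    (∀ φ : 𝓢(EuclideanSpace ℝ (Fin d), ℂ), HasCompactSupport φ → tsupport φ ⊆ U →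
      v φ = ∫ x, g x * φ x) →
    ∀ φ : 𝓢(EuclideanSpace ℝ (Fin d), ℂ), HasCompactSupport φ → tsupport φ ⊆ U →
      w φ = ∫ x, η x * g x * φ x

/-- `u ∈ C([0, T); H^γ)` is a strong solution on `[0, T)` of the Cauchy problem
`i ∂ₜu + Δu + ηu = 0`, `u(0) = u₀`: there is `w` with `w(s) = η u(s)` for almost every `s`, and
`u(t) = u₀ + i ∫₀ᵗ (Δu(s) + w(s)) ds` holds in the sense of tempered distributions. -/
structure IsStrongSolution {d : ℕ} (η : EuclideanSpace ℝ (Fin d) → ℂ) (γ : ℝ) (T : ℝ≥0∞)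
    (u₀ : 𝓢'(EuclideanSpace ℝ (Fin d), ℂ)) (u : ℝ → 𝓢'(EuclideanSpace ℝ (Fin d), ℂ)) : Prop where
  initial : u 0 = u₀
  memSobolev : ∀ t ∈ timeInterval T, MemSobolev γ 2 (u t)
  continuous : ∀ t ∈ timeInterval T,
    Tendsto (fun s => sobolevNorm γ (u s - u t)) (𝓝[timeInterval T] t) (𝓝 0)
  equation : ∃ w : ℝ → 𝓢'(EuclideanSpace ℝ (Fin d), ℂ),
    (∀ᵐ s ∂volume.restrict (timeInterval T), IsPotentialMul η (u s) (w s)) ∧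
    ∀ φ : 𝓢(EuclideanSpace ℝ (Fin d), ℂ), ∀ t ∈ timeInterval T,
      IntervalIntegrable (fun s => w s φ) volume 0 t ∧
      u t φ = u₀ φ + Complex.I * ∫ s in (0 : ℝ)..t, ((Δ (u s)) φ + w s φ)

/-- Local well-posedness of `i ∂ₜu + Δu + ηu = 0` in `H^γ(ℝ^d)`. There are auxiliary classes
`X T` of functions on `[0, T)`, a lifespan `Tmax` and a solution map `Φ` such that
1. every `u₀ ∈ H^γ` has the strong solution `Φ u₀` on `[0, Tmax u₀)`, which lies in the
   auxiliary class;
2. it is unique and maximal: every strong solution in the auxiliary class with data `u₀` lives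
   on a subinterval and agrees with it there;
3. for every `t` the map `u₀ ↦ Φ u₀ t`, on the data whose solution lives at time `t`, is
   continuous from `H^γ` to `H^γ`.

The auxiliary classes are arbitrary: no norm or linear structure is asked of them, which makes
this notion as easy to satisfy as possible. -/
def LocallyWellPosed {d : ℕ} (η : EuclideanSpace ℝ (Fin d) → ℂ) (γ : ℝ) : Prop :=
  ∃ (X : ℝ≥0∞ → Set (ℝ → 𝓢'(EuclideanSpace ℝ (Fin d), ℂ)))
    (Tmax : 𝓢'(EuclideanSpace ℝ (Fin d), ℂ) → ℝ≥0∞)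
    (Φ : 𝓢'(EuclideanSpace ℝ (Fin d), ℂ) → ℝ → 𝓢'(EuclideanSpace ℝ (Fin d), ℂ)),
    (∀ u₀, MemSobolev γ 2 u₀ →
      0 < Tmax u₀ ∧ IsStrongSolution η γ (Tmax u₀) u₀ (Φ u₀) ∧ Φ u₀ ∈ X (Tmax u₀)) ∧
    (∀ u₀, MemSobolev γ 2 u₀ → ∀ (T : ℝ≥0∞) (u : ℝ → 𝓢'(EuclideanSpace ℝ (Fin d), ℂ)),
      IsStrongSolution η γ T u₀ u → u ∈ X T →
        T ≤ Tmax u₀ ∧ Set.EqOn u (Φ u₀) (timeInterval T)) ∧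
    (∀ u₀, MemSobolev γ 2 u₀ → ∀ t ∈ timeInterval (Tmax u₀), ∀ ε : ℝ≥0∞, 0 < ε →
      ∃ δ : ℝ≥0∞, 0 < δ ∧ ∀ v₀, MemSobolev γ 2 v₀ → t ∈ timeInterval (Tmax v₀) →
        sobolevNorm γ (v₀ - u₀) < δ → sobolevNorm γ (Φ v₀ t - Φ u₀ t) < ε)

/-- Ill-posedness in `H^γ`: well-posedness fails. -/
def IllPosed {d : ℕ} (η : EuclideanSpace ℝ (Fin d) → ℂ) (γ : ℝ) : Prop :=
  ¬ LocallyWellPosed η γ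

/-- The data-to-solution correspondence is discontinuous at the zero solution in `H^γ`: some
Schwartz data `f n` tend to `0` in `H^γ`, while on every time interval `[0, T)` all strong
solutions with data `f n` become unboundedly large in `H^γ`, uniformly, as `n → ∞`. In
particular no choice of strong solutions depends continuously on the data at `0`, in
`C([0, T); H^γ)`. -/
def DiscontinuousAtZero {d : ℕ} (η : EuclideanSpace ℝ (Fin d) → ℂ) (γ : ℝ) : Prop :=
  ∃ f : ℕ → 𝓢(EuclideanSpace ℝ (Fin d), ℂ),
    Tendsto (fun n => sobolevNorm γ (f n : 𝓢'(EuclideanSpace ℝ (Fin d), ℂ))) atTop (𝓝 0) ∧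
    ∀ T : ℝ≥0∞, 0 < T → ∀ C : ℝ≥0∞, C < ∞ → ∀ᶠ n in atTop,
      ∀ u : ℝ → 𝓢'(EuclideanSpace ℝ (Fin d), ℂ),
        IsStrongSolution η γ T (f n : 𝓢'(EuclideanSpace ℝ (Fin d), ℂ)) u →
          ∃ t ∈ timeInterval T, C < sobolevNorm γ (u t)

/-! For `η = -i a` with `a ≥ 0` the equation reads `∂ₜu = iΔu + a u`, so the potential amplifies.
Take `a = L ^ κ`, `L = 2 ^ n`, on the annulus `‖x‖ ~ 1 / L`. Dispersion across this annulus takes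
time about `L ^ (-2)` and amplification only `L ^ (-κ)`. For `κ > 2` amplification wins, while `κ r
< d` keeps `η` in `L^r`; both are possible exactly because `r < d / 2`.

To see this for an arbitrary strong solution, test it against `Δ^[k] ψ`, with `ψ` a bump in the
annulus. The moments `m k` satisfy `m k' = i m (k + 1) + a m k`, a closed hierarchy that sees `η`
only where it is constant. If the datum near the annulus lives where `ψ = 1`, all moments with `k ≥
1` vanish initially. After the factor `exp (-a t)` is removed, `K` integrations give `‖m 0 0‖ ≤ exp
(-a τ) ‖m 0 τ‖ + τ ^ K sup ‖m K‖` (`norm_initial_le_of_hierarchy`). A bound on `u` in `H^γ` makes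
the right side smaller than any given power of `1 / L`, since duality costs only a fixed power of
`L`, whatever `γ` is. Data of polynomial size in `1 / L` contradict this
(`eventually_sobolevNorm_large`).

Single rescaled bumps give the discontinuity at zero. Their sum over all scales is a datum in `H^γ`
with no strong solution at all, hence ill-posedness. -/

/-! ### Duality for the Sobolev norm -/

section Sobolev

variable {d : ℕ}

open FourierTransform

local notation "𝔼" => EuclideanSpace ℝ (Fin d)

/-- The operator on Schwartz functions whose transpose is the Bessel potential of order `s`. -/
noncomputable def besselTranspose (s : ℝ) : 𝓢(𝔼, ℂ) →L[ℂ] 𝓢(𝔼, ℂ) :=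
  (fourierCLM ℂ 𝓢(𝔼, ℂ)) ∘L
    (SchwartzMap.smulLeftCLM ℂ (fun x : 𝔼 ↦ (((1 + ‖x‖ ^ 2) ^ (s / 2) : ℝ) : ℂ))) ∘L
      (fourierInvCLM ℂ 𝓢(𝔼, ℂ))

theorem besselPotential_apply_eq (s : ℝ) (v : 𝓢'(𝔼, ℂ)) (φ : 𝓢(𝔼, ℂ)) :
    besselPotential 𝔼 ℂ s v φ = v (besselTranspose s φ) := rfl

/-- The Bessel potential of order `γ` of a Schwartz function, as an `L²` function; its norm is the
norm of `H^γ`. -/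
noncomputable def schwartzSobolevLp (γ : ℝ) :
    𝓢(𝔼, ℂ) →L[ℂ] Lp ℂ 2 (volume : Measure 𝔼) :=
  (SchwartzMap.toLpCLM ℂ ℂ 2 (volume : Measure 𝔼)) ∘L
    (SchwartzMap.fourierMultiplierCLM ℂ (fun x : 𝔼 ↦ (((1 + ‖x‖ ^ 2) ^ (γ / 2) : ℝ) : ℂ)))

theorem besselPotential_coe_schwartz (γ : ℝ) (f : 𝓢(𝔼, ℂ)) :
    besselPotential 𝔼 ℂ γ (f : 𝓢'(𝔼, ℂ)) = (schwartzSobolevLp γ f : Lp ℂ 2 _) := by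
  simp only [schwartzSobolevLp, ContinuousLinearMap.comp_apply, SchwartzMap.toLpCLM_apply]
  rw [besselPotential, Lp.toTemperedDistribution_toLp_eq,
    fourierMultiplierCLM_toTemperedDistributionCLM_eq (by fun_prop)]

/-- An `L²` function attached to a Schwartz function, whose norm is dual to the norm of `H^γ`. -/
noncomputable def dualSobolevLp (γ : ℝ) :
    𝓢(𝔼, ℂ) →L[ℂ] Lp ℂ 2 (volume : Measure 𝔼) :=
  (SchwartzMap.toLpCLM ℂ ℂ 2 (volume : Measure 𝔼)) ∘L (besselTranspose (-γ))

theorem sobolevNorm_le_of_eq {γ : ℝ} {v : 𝓢'(𝔼, ℂ)} {g : Lp ℂ 2 (volume : Measure 𝔼)}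
    (h : besselPotential 𝔼 ℂ γ v = g) : sobolevNorm γ v ≤ ‖g‖ₑ :=
  iInf₂_le g h

theorem norm_toTemperedDistribution_apply_le (g : Lp ℂ 2 (volume : Measure 𝔼)) (φ : 𝓢(𝔼, ℂ)) :
    ‖(g : 𝓢'(𝔼, ℂ)) φ‖ ≤ ‖g‖ * ‖φ.toLp 2 (volume : Measure 𝔼)‖ := by
  have key : ‖(g : 𝓢'(𝔼, ℂ)) φ‖ₑ ≤ ‖g‖ₑ * ‖φ.toLp 2 (volume : Measure 𝔼)‖ₑ := by
    rw [Lp.toTemperedDistribution_apply, Lp.enorm_def, Lp.enorm_def,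
      eLpNorm_congr_ae (φ.coeFn_toLp 2 (volume : Measure 𝔼)), mul_comm]
    refine (enorm_integral_le_lintegral_enorm _).trans ?_
    rw [← eLpNorm_one_eq_lintegral_enorm]
    exact eLpNorm_smul_le_mul_eLpNorm (p := 2) (q := 2) (r := 1) (f := g) (φ := φ)
      (Lp.aestronglyMeasurable g) φ.continuous.aestronglyMeasurable
  rw [← ofReal_norm, ← ofReal_norm, ← ofReal_norm, ← ENNReal.ofReal_mul (norm_nonneg _)] at key
  exact (ENNReal.ofReal_le_ofReal_iff (by positivity)).1 key

theorem apply_eq_dual {γ : ℝ} {v : 𝓢'(𝔼, ℂ)} {g : Lp ℂ 2 (volume : Measure 𝔼)}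
    (h : besselPotential 𝔼 ℂ γ v = g) (φ : 𝓢(𝔼, ℂ)) :
    v φ = (g : 𝓢'(𝔼, ℂ)) (besselTranspose (-γ) φ) := by
  rw [← besselPotential_apply_eq, ← h, besselPotential_besselPotential_apply]
  simp

theorem norm_apply_le_of_sobolevNorm_le {γ C : ℝ} (hC : 0 ≤ C) {v : 𝓢'(𝔼, ℂ)}
    (hv : sobolevNorm γ v ≤ ENNReal.ofReal C) (φ : 𝓢(𝔼, ℂ)) :
    ‖v φ‖ ≤ C * ‖dualSobolevLp γ φ‖ := by
  -- The norm is an infimum, so a representative is extracted from a strict inequality and the slack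
  -- `ε` is then removed.
  suffices h : ∀ ε : ℝ, 0 < ε → ‖v φ‖ ≤ (C + ε) * ‖dualSobolevLp γ φ‖ by
    have hlim : Tendsto (fun ε : ℝ ↦ (C + ε) * ‖dualSobolevLp γ φ‖) (𝓝[>] 0)
        (𝓝 ((C + 0) * ‖dualSobolevLp γ φ‖)) :=
      (Continuous.tendsto (by fun_prop) 0).mono_left nhdsWithin_le_nhds
    rw [add_zero] at hlim
    exact ge_of_tendsto hlim (eventually_nhdsWithin_of_forall h)
  intro ε hε
  have hlt : sobolevNorm γ v < ENNReal.ofReal (C + ε) :=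
    hv.trans_lt ((ENNReal.ofReal_lt_ofReal_iff (by linarith)).2 (by linarith))
  simp only [sobolevNorm, iInf_lt_iff] at hlt
  obtain ⟨g, hg, hlt⟩ := hlt
  rw [apply_eq_dual hg]
  refine (norm_toTemperedDistribution_apply_le _ _).trans ?_
  have : ‖g‖ ≤ C + ε := by
    rw [← ofReal_norm] at hlt
    exact ((ENNReal.ofReal_lt_ofReal_iff (by linarith)).1 hlt).le
  exact mul_le_mul_of_nonneg_right this (norm_nonneg _)

theorem sobolevNorm_add_le (γ : ℝ) (v w : 𝓢'(𝔼, ℂ)) :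
    sobolevNorm γ (v + w) ≤ sobolevNorm γ v + sobolevNorm γ w := by
  simp only [sobolevNorm, ENNReal.iInf_add, ENNReal.add_iInf]
  refine le_iInf₂ fun f hf ↦ le_iInf₂ fun g hg ↦ ?_
  have h : besselPotential 𝔼 ℂ γ (v + w) = ((g + f : Lp ℂ 2 (volume : Measure 𝔼)) : 𝓢'(𝔼, ℂ)) := by
    rw [map_add, hf, hg, ← Lp.toTemperedDistributionCLM_apply, ← Lp.toTemperedDistributionCLM_apply,
      ← Lp.toTemperedDistributionCLM_apply, map_add, add_comm]
  exact (iInf₂_le (g + f) h).trans (enorm_add_le g f)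

theorem sobolevNorm_lt_top {γ : ℝ} {v : 𝓢'(𝔼, ℂ)} (hv : MemSobolev γ 2 v) :
    sobolevNorm γ v < ∞ := by
  obtain ⟨g, hg⟩ := hv
  exact (sobolevNorm_le_of_eq hg).trans_lt enorm_lt_top

end Sobolev

/-! ### Growth of moments where the potential is constant -/

section Growth

theorem hasDerivWithinAt_of_eq_integral {τ : ℝ} {m q : ℝ → ℂ}
    (hq : ContinuousOn q (Set.Icc 0 τ))
    (h : ∀ t ∈ Set.Icc 0 τ, m t = m 0 + ∫ s in (0 : ℝ)..t, q s) {t : ℝ} (ht : t ∈ Set.Icc 0 τ) :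
    HasDerivWithinAt m (q t) (Set.Icc 0 τ) t := by
  -- Needed by the `FTCFilter` instance for `𝓝[Icc 0 τ] t`, which covers the endpoints as well.
  have : Fact (t ∈ Set.Icc 0 τ) := ⟨ht⟩
  have hint : IntervalIntegrable q volume 0 t :=
    (hq.mono (by rw [Set.uIcc_of_le ht.1]; exact Set.Icc_subset_Icc_right ht.2)).intervalIntegrable
  have hd := intervalIntegral.integral_hasDerivWithinAt_right (s := Set.Icc 0 τ) (t := Set.Icc 0 τ)
    hint (hq.stronglyMeasurableAtFilter_nhdsWithin measurableSet_Icc t) (hq t ht)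
  exact (hd.const_add (m 0)).congr h (h t ht)

/-- A hierarchy `m k' = i m (k + 1) + a m k`, in which only `m 0` starts from a nonzero value. -/
theorem norm_initial_le_of_hierarchy {m : ℕ → ℝ → ℂ} {a τ B : ℝ} {K : ℕ} (hτ : 0 ≤ τ) (ha : 0 ≤ a)
    (hcont : ∀ k, ContinuousOn (m k) (Set.Icc 0 τ))
    (heq : ∀ k, ∀ t ∈ Set.Icc 0 τ,
      m k t = m k 0 + ∫ s in (0 : ℝ)..t, (Complex.I * m (k + 1) s + a * m k s))
    (hz : ∀ k, 1 ≤ k → k < K → m k 0 = 0) (hB : ∀ t ∈ Set.Icc 0 τ, ‖m K t‖ ≤ B) (hK : 0 < K) :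
    ‖m 0 0‖ ≤ Real.exp (-(a * τ)) * ‖m 0 τ‖ + τ ^ K * B := by
  -- The integrating factor reduces the hierarchy to `g k' = i g (k + 1)`.
  set g : ℕ → ℝ → ℂ := fun k t ↦ Complex.exp (-((a : ℂ) * t)) * m k t with hg
  have hnorm (k : ℕ) (t : ℝ) : ‖g k t‖ = Real.exp (-(a * t)) * ‖m k t‖ := by
    simp [hg, Complex.norm_exp]
  have hzero (k : ℕ) : g k 0 = m k 0 := by simp [hg]
  have hder (k : ℕ) (t : ℝ) (ht : t ∈ Set.Icc 0 τ) :
      HasDerivWithinAt (g k) (Complex.I * g (k + 1) t) (Set.Icc 0 τ) t := by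
    have h1 := hasDerivWithinAt_of_eq_integral
      (((hcont (k + 1)).const_mul Complex.I).add ((hcont k).const_mul (a : ℂ))) (heq k) ht
    have h2 : HasDerivWithinAt (fun s : ℝ ↦ Complex.exp (-((a : ℂ) * s)))
        (Complex.exp (-((a : ℂ) * t)) * (-((a : ℂ) * 1))) (Set.Icc 0 τ) t :=
      ((Complex.ofRealCLM.hasDerivAt (x := t)).const_mul (a : ℂ)).neg.cexp.hasDerivWithinAt
    refine HasDerivWithinAt.congr_deriv (h2.mul h1) ?_
    simp only [hg, Pi.add_apply]
    ring
  have step (k : ℕ) (c : ℝ) (h : ∀ t ∈ Set.Icc 0 τ, ‖g (k + 1) t‖ ≤ c) :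
      ∀ t ∈ Set.Icc 0 τ, ‖g k t - g k 0‖ ≤ τ * c := by
    intro t ht
    have hc : 0 ≤ c := (norm_nonneg _).trans (h t ht)
    refine (norm_image_sub_le_of_norm_deriv_le_segment' (hder k) (C := c) ?_ t ht).trans ?_
    · intro s hs
      simpa using h s (Set.Ico_subset_Icc_self hs)
    · rw [sub_zero, mul_comm]
      exact mul_le_mul_of_nonneg_right ht.2 hc
  -- Descending from level `K` to level `1`, each integration gains a factor `τ`, because `g k`
  -- starts from zero there. Level `0` is treated separately, as its initial value is the quantity
  -- to be bounded.
  have main : ∀ j, j < K → ∀ t ∈ Set.Icc 0 τ, ‖g (K - j) t‖ ≤ τ ^ j * B := by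
    intro j
    induction j with
    | zero =>
      intro _ t ht
      rw [hnorm, Nat.sub_zero, pow_zero]
      refine mul_le_mul ?_ (hB t ht) (norm_nonneg _) zero_le_one
      exact Real.exp_le_one_iff.2 (neg_nonpos.2 (mul_nonneg ha ht.1))
    | succ j ih =>
      intro hj t ht
      have hk : K - j = K - (j + 1) + 1 := by omega
      have := step (K - (j + 1)) (τ ^ j * B) (by rw [← hk]; exact ih (by omega)) t ht
      rw [hzero, hz _ (by omega) (by omega), sub_zero] at this
      rw [pow_succ]
      linarith
  have h1 := main (K - 1) (by omega)
  rw [show K - (K - 1) = 0 + 1 by omega] at h1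
  have h2 := step 0 _ h1 τ ⟨hτ, le_rfl⟩
  have h3 : τ * (τ ^ (K - 1) * B) = τ ^ K * B := by
    rw [← mul_assoc, ← pow_succ', Nat.sub_add_cancel hK]
  rw [h3] at h2
  rw [← hzero, ← hnorm]
  have := norm_sub_norm_le (g 0 0) (g 0 τ)
  rw [norm_sub_rev] at this
  linarith

variable {d : ℕ}

local notation "𝔼" => EuclideanSpace ℝ (Fin d)

theorem tsupport_laplacian_subset (φ : 𝓢(𝔼, ℂ)) :
    tsupport (Δ φ : 𝓢(𝔼, ℂ)) ⊆ tsupport φ := by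
  refine closure_minimal (fun x hx ↦ ?_) (isClosed_tsupport _)
  by_contra h
  refine hx ?_
  have h0 : (φ : 𝔼 → ℂ) =ᶠ[𝓝 x] fun _ ↦ (0 : ℂ) := notMem_tsupport_iff_eventuallyEq.1 h
  rw [SchwartzMap.laplacian_apply, (InnerProductSpace.laplacian_congr_nhds h0).eq_of_nhds]
  simp

theorem tsupport_iterate_laplacian_subset (k : ℕ) (φ : 𝓢(𝔼, ℂ)) :
    tsupport (Δ^[k] φ : 𝓢(𝔼, ℂ)) ⊆ tsupport φ := by
  induction k with
  | zero => rfl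
  | succ k ih =>
    rw [Function.iterate_succ_apply']
    exact (tsupport_laplacian_subset _).trans ih

theorem IsStrongSolution.continuousOn_apply {η : 𝔼 → ℂ} {γ : ℝ} {T : ℝ≥0∞} {u₀ : 𝓢'(𝔼, ℂ)}
    {u : ℝ → 𝓢'(𝔼, ℂ)} (hu : IsStrongSolution η γ T u₀ u) (φ : 𝓢(𝔼, ℂ)) :
    ContinuousOn (fun t ↦ u t φ) (timeInterval T) := by
  intro t ht
  rw [ContinuousWithinAt, Metric.tendsto_nhds]
  intro ε hε
  set N := ‖dualSobolevLp γ φ‖ with hN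
  have hδ : 0 < ε / (N + 1) := by positivity
  filter_upwards [(hu.continuous t ht).eventually_le_const (ENNReal.ofReal_pos.2 hδ)] with s hs
  have := norm_apply_le_of_sobolevNorm_le hδ.le hs φ
  rw [dist_eq_norm]
  calc ‖u s φ - u t φ‖ ≤ ε / (N + 1) * N := this
    _ < ε / (N + 1) * (N + 1) := by gcongr; linarith
    _ = ε := div_mul_cancel₀ _ (by positivity)

/-- The supports of all `Δ^[k] ψ` stay in `U`, where `η` is constant, so only the smooth clause of
`IsPotentialMul` is involved and the moments `u t (Δ^[k] ψ)` obey the hierarchy. Duality turns the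
bound in `H^γ` into bounds on the moments. -/
theorem IsStrongSolution.norm_initial_apply_le {η : 𝔼 → ℂ} {γ : ℝ} {T : ℝ≥0∞} {u₀ : 𝓢'(𝔼, ℂ)}
    {u : ℝ → 𝓢'(𝔼, ℂ)} (hu : IsStrongSolution η γ T u₀ u) {U : Set 𝔼} (hU : IsOpen U) {a : ℝ}
    (ha : 0 ≤ a) (hη : ∀ x ∈ U, η x = -(Complex.I * a)) {ψ : 𝓢(𝔼, ℂ)} (hψ : HasCompactSupport ψ)
    (hψU : tsupport ψ ⊆ U) {τ : ℝ} (hτ : τ ∈ timeInterval T) {C : ℝ} (hC : 0 ≤ C)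
    (hbound : ∀ t ∈ Set.Icc 0 τ, sobolevNorm γ (u t) ≤ ENNReal.ofReal C) {K : ℕ} (hK : 0 < K)
    (hz : ∀ k, 1 ≤ k → k < K → u₀ (Δ^[k] ψ) = 0) :
    ‖u₀ ψ‖ ≤ C * (Real.exp (-(a * τ)) * ‖dualSobolevLp γ ψ‖ +
      τ ^ K * ‖dualSobolevLp γ (Δ^[K] ψ)‖) := by
  have hsub : Set.Icc 0 τ ⊆ timeInterval T := fun t ht ↦
    ⟨ht.1, (ENNReal.ofReal_le_ofReal ht.2).trans_lt hτ.2⟩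
  obtain ⟨w, hw, hwu⟩ := hu.equation
  have hwφ (k : ℕ) : ∀ᵐ s ∂volume.restrict (timeInterval T),
      w s (Δ^[k] ψ) = -(Complex.I * a) * u s (Δ^[k] ψ) := by
    filter_upwards [hw] with s hs
    have hk := tsupport_iterate_laplacian_subset k ψ
    rw [hs.smooth U (fun _ ↦ -(Complex.I * a)) hU (by fun_prop)
      (ae_restrict_of_forall_mem hU.measurableSet hη) _
      (hψ.mono' (subset_closure.trans hk)) (hk.trans hψU)]
    simp
  have key := norm_initial_le_of_hierarchy (m := fun k t ↦ u t (Δ^[k] ψ)) (a := a) (K := K)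
    (B := C * ‖dualSobolevLp γ (Δ^[K] ψ)‖) hτ.1 ha
    (fun k ↦ (hu.continuousOn_apply _).mono hsub) ?_ ?_
    (fun t ht ↦ norm_apply_le_of_sobolevNorm_le hC (hbound t ht) _) hK
  · simp only [Function.iterate_zero_apply, hu.initial] at key
    have h1 := norm_apply_le_of_sobolevNorm_le hC (hbound τ ⟨hτ.1, le_rfl⟩) ψ
    have h2 := mul_le_mul_of_nonneg_left h1 (Real.exp_nonneg (-(a * τ)))
    linarith
  · intro k t ht
    rw [(hwu (Δ^[k] ψ) t (hsub ht)).2, hu.initial, ← intervalIntegral.integral_const_mul]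
    congr 1
    apply intervalIntegral.integral_congr_ae_restrict
    have hsub' : Set.uIoc 0 t ⊆ timeInterval T := by
      rw [Set.uIoc_of_le ht.1]
      exact fun s hs ↦ hsub ⟨hs.1.le, hs.2.trans ht.2⟩
    filter_upwards [ae_restrict_of_ae_restrict_of_subset hsub' (hwφ k)] with s hs
    rw [hs, TemperedDistribution.laplacian_apply_apply, Function.iterate_succ_apply']
    linear_combination (-(a : ℂ) * u s (Δ^[k] ψ)) * Complex.I_mul_I
  · intro k h1 h2
    simpa [hu.initial] using hz k h1 h2

end Growth

/-! ### Dilations and bump functions -/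

section Dilation

variable {d : ℕ}

open LineDeriv

local notation "𝔼" => EuclideanSpace ℝ (Fin d)

/-- The dilation of a Schwartz function by the factor `2 ^ n`. -/
noncomputable def dilation (n : ℕ) : 𝓢(𝔼, ℂ) →L[ℂ] 𝓢(𝔼, ℂ) :=
  SchwartzMap.compCLMOfContinuousLinearEquiv ℂ
    (ContinuousLinearEquiv.smulLeft (Units.mk0 ((2 : ℝ) ^ n) (by positivity)) : 𝔼 ≃L[ℝ] 𝔼)

theorem dilation_apply (n : ℕ) (φ : 𝓢(𝔼, ℂ)) (x : 𝔼) :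
    dilation n φ x = φ ((2 : ℝ) ^ n • x) := rfl

theorem laplacian_dilation (n : ℕ) (φ : 𝓢(𝔼, ℂ)) :
    Δ (dilation n φ) = ((4 : ℂ) ^ n) • dilation n (Δ φ) := by
  have h (m : 𝔼) (f : 𝓢(𝔼, ℂ)) : ∂_{m} (dilation n f) = ((2 : ℂ) ^ n) • dilation n (∂_{m} f) := by
    rw [dilation, SchwartzMap.lineDerivOp_compCLMOfContinuousLinearEquiv]
    have : (ContinuousLinearEquiv.smulLeft (Units.mk0 ((2 : ℝ) ^ n) (by positivity)) : 𝔼 ≃L[ℝ] 𝔼) m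
      = (2 : ℝ) ^ n • m := rfl
    rw [this]
    ext x
    simp [SchwartzMap.lineDerivOp_apply_eq_fderiv]
  simp only [SchwartzMap.laplacian_eq_sum (stdOrthonormalBasis ℝ 𝔼), map_sum, Finset.smul_sum]
  refine Finset.sum_congr rfl fun i _ ↦ ?_
  rw [h, lineDerivOp_smul, h, smul_smul, ← mul_pow]
  norm_num

theorem iterate_laplacian_dilation (n k : ℕ) (φ : 𝓢(𝔼, ℂ)) :
    Δ^[k] (dilation n φ) = (((4 : ℂ) ^ n) ^ k) • dilation n (Δ^[k] φ) := by
  induction k with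
  | zero => simp
  | succ k ih =>
    have hs (c : ℂ) (f : 𝓢(𝔼, ℂ)) : Δ (c • f) = c • Δ f := by
      rw [← SchwartzMap.laplacianCLM_eq ℂ, map_smul, SchwartzMap.laplacianCLM_eq]
    rw [Function.iterate_succ_apply', Function.iterate_succ_apply', ih, hs, laplacian_dilation,
      smul_smul, pow_succ]

/-- Each derivative costs a factor `2 ^ n`, whereas the weight `‖x‖ ^ k` costs nothing because `2 ^
n ≥ 1`. -/
theorem seminorm_dilation_le (k l n : ℕ) (φ : 𝓢(𝔼, ℂ)) :
    SchwartzMap.seminorm ℂ k l (dilation n φ) ≤ ((2 : ℝ) ^ n) ^ l * SchwartzMap.seminorm ℂ k l φ := by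
  have h2 : (1 : ℝ) ≤ 2 ^ n := one_le_pow₀ one_le_two
  refine SchwartzMap.seminorm_le_bound _ _ _ _ (by positivity) fun x ↦ ?_
  set g : 𝔼 →L[ℝ] 𝔼 := (2 : ℝ) ^ n • ContinuousLinearMap.id ℝ 𝔼 with hg
  have hfun : (dilation n φ : 𝔼 → ℂ) = φ ∘ g := by
    ext y; simp [hg, dilation_apply]
  have hgn : ‖g‖ ≤ 2 ^ n := by
    refine ContinuousLinearMap.opNorm_le_bound _ (by positivity) fun y ↦ ?_
    simp [hg, norm_smul]
  have hgx : ‖x‖ ≤ ‖g x‖ := by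
    simp only [hg, smul_apply, ContinuousLinearMap.id_apply, norm_smul, norm_pow,
      Real.norm_ofNat]
    exact le_mul_of_one_le_left (norm_nonneg _) h2
  rw [hfun, g.iteratedFDeriv_comp_right (n := l) (φ.smooth l) x le_rfl]
  have h1 := ContinuousMultilinearMap.norm_compContinuousLinearMap_le
    (iteratedFDeriv ℝ l φ (g x)) (fun _ ↦ g)
  have h3 := SchwartzMap.le_seminorm ℂ k l φ (g x)
  rw [Finset.prod_const, Finset.card_univ, Fintype.card_fin] at h1
  calc _ ≤ ‖g x‖ ^ k * (‖iteratedFDeriv ℝ l φ (g x)‖ * (2 ^ n) ^ l) := by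
        gcongr
        exact h1.trans (by gcongr)
    _ = ((2 : ℝ) ^ n) ^ l * (‖g x‖ ^ k * ‖iteratedFDeriv ℝ l φ (g x)‖) := by ring
    _ ≤ _ := by gcongr

/-- A continuous linear image of a dilated Schwartz function grows at most polynomially. -/
theorem exists_norm_dilation_le {H : Type*} [NormedAddCommGroup H] [NormedSpace ℂ H]
    (L : 𝓢(𝔼, ℂ) →L[ℂ] H) :
    ∃ M : ℕ, ∀ φ : 𝓢(𝔼, ℂ), ∃ A : ℝ, 0 ≤ A ∧ ∀ n, ‖L (dilation n φ)‖ ≤ A * ((2 : ℝ) ^ n) ^ M := by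
  obtain ⟨s, C, -, hC⟩ := Seminorm.bound_of_continuous (schwartz_withSeminorms ℂ 𝔼 ℂ)
    ((normSeminorm ℂ H).comp L.toLinearMap) (by exact L.continuous.norm)
  -- The exponent is the highest derivative order in the controlling seminorms, hence independent of
  -- `φ`. This matters when `φ = Δ^[K] ψ` with `K` chosen in terms of `M`.
  refine ⟨s.sup Prod.snd, fun φ ↦ ⟨C * ∑ i ∈ s, SchwartzMap.seminorm ℂ i.1 i.2 φ,
    mul_nonneg C.2 (Finset.sum_nonneg fun _ _ ↦ apply_nonneg _ _), fun n ↦ ?_⟩⟩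
  have h2 : (1 : ℝ) ≤ 2 ^ n := one_le_pow₀ one_le_two
  refine (hC (dilation n φ)).trans ?_
  rw [smul_apply, NNReal.smul_def, smul_eq_mul, mul_assoc]
  refine mul_le_mul_of_nonneg_left ?_ C.2
  refine Seminorm.finset_sup_apply_le (by positivity) fun i hi ↦ ?_
  refine (seminorm_dilation_le i.1 i.2 n φ).trans ?_
  rw [mul_comm]
  gcongr
  · exact Finset.single_le_sum (f := fun i : ℕ × ℕ ↦ SchwartzMap.seminorm ℂ i.1 i.2 φ)
      (fun _ _ ↦ apply_nonneg _ _) hi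
  · exact Finset.le_sup (f := Prod.snd) hi

theorem integral_dilation (n : ℕ) (φ : 𝓢(𝔼, ℂ)) :
    ∫ x, dilation n φ x = (((2 : ℂ) ^ n) ^ d)⁻¹ * ∫ x, φ x := by
  simp_rw [dilation_apply]
  rw [Measure.integral_comp_smul volume (fun x ↦ φ x) ((2 : ℝ) ^ n)]
  rw [abs_of_pos (by positivity)]
  simp [Complex.real_smul]

theorem iterate_laplacian_eq_zero_of_eqOn_one {U : Set 𝔼} (hU : IsOpen U) {φ : 𝓢(𝔼, ℂ)}
    (h : ∀ x ∈ U, φ x = 1) (k : ℕ) : ∀ x ∈ U, (Δ^[k + 1] φ) x = 0 := by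
  have key (c : ℂ) (f : 𝓢(𝔼, ℂ)) (hf : ∀ x ∈ U, f x = c) : ∀ x ∈ U, (Δ f) x = 0 := by
    intro x hx
    have h0 : (f : 𝔼 → ℂ) =ᶠ[𝓝 x] fun _ ↦ c := by
      filter_upwards [hU.mem_nhds hx] with y hy using hf y hy
    rw [SchwartzMap.laplacian_apply, (InnerProductSpace.laplacian_congr_nhds h0).eq_of_nhds]
    simp
  induction k with
  | zero => exact key 1 φ h
  | succ k ih =>
    rw [Function.iterate_succ_apply']
    exact key 0 _ ih

/-- A pair of bump functions in the annulus `1 < ‖x‖ < 2`, the second of which is equal to one on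
the support of the first. -/
theorem exists_bump_pair (hd : 0 < d) : ∃ f ψ : 𝓢(𝔼, ℂ),
    (∀ x, f x ≠ 0 → 1 < ‖x‖ ∧ ‖x‖ < 2) ∧ HasCompactSupport ψ ∧
    (∀ x ∈ tsupport ψ, 1 < ‖x‖ ∧ ‖x‖ < 2) ∧ (∀ x, f x * ψ x = f x) ∧
    (∀ k x, f x * (Δ^[k + 1] ψ) x = 0) ∧ ∫ x, f x ≠ 0 := by
  have : Nonempty (Fin d) := ⟨⟨0, hd⟩⟩
  obtain ⟨c, hc⟩ := exists_norm_eq 𝔼 (c := 3 / 2) (by norm_num)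
  have hball (x : 𝔼) (ρ : ℝ) (hρ : ρ < 1 / 2) (hx : dist x c ≤ ρ) : 1 < ‖x‖ ∧ ‖x‖ < 2 := by
    rw [dist_eq_norm] at hx
    have h1 := norm_sub_norm_le x c
    have h2 := norm_sub_norm_le c x
    rw [norm_sub_rev] at h2
    constructor <;> linarith
  -- The outer radius of the first bump equals the inner radius of the second, and `3 / 8 < 1 / 2`
  -- keeps both in the annulus, as `‖c‖ = 3 / 2`.
  let bf : ContDiffBump c := ⟨1 / 8, 1 / 4, by norm_num, by norm_num⟩
  let bψ : ContDiffBump c := ⟨1 / 4, 3 / 8, by norm_num, by norm_num⟩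
  have hsf : HasCompactSupport (fun x ↦ (bf x : ℂ)) :=
    bf.hasCompactSupport.comp_left Complex.ofReal_zero
  have hsψ : HasCompactSupport (fun x ↦ (bψ x : ℂ)) :=
    bψ.hasCompactSupport.comp_left Complex.ofReal_zero
  have hcf : ContDiff ℝ (⊤ : ℕ∞) (fun x ↦ (bf x : ℂ)) :=
    Complex.ofRealCLM.contDiff.comp bf.contDiff
  have hcψ : ContDiff ℝ (⊤ : ℕ∞) (fun x ↦ (bψ x : ℂ)) :=
    Complex.ofRealCLM.contDiff.comp bψ.contDiff
  have hfball (x : 𝔼) (hx : (bf x : ℂ) ≠ 0) : x ∈ Metric.ball c (1 / 4) := by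
    have : x ∈ Function.support bf := by simpa using hx
    rwa [bf.support_eq] at this
  have hone (x : 𝔼) (hx : x ∈ Metric.ball c (1 / 4)) : (bψ x : ℂ) = 1 := by
    rw [bψ.one_of_mem_closedBall (Metric.ball_subset_closedBall hx), Complex.ofReal_one]
  refine ⟨hsf.toSchwartzMap hcf, hsψ.toSchwartzMap hcψ, ?_, ?_, ?_, ?_, ?_, ?_⟩
  · intro x hx
    exact hball x (1 / 4) (by norm_num) (Metric.mem_ball.1 (hfball x hx)).le
  · exact hsψ
  · intro x hx
    have : x ∈ tsupport bψ := closure_mono (fun y hy ↦ by simpa using hy) hx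
    rw [bψ.tsupport_eq] at this
    exact hball x (3 / 8) (by norm_num) this
  · intro x
    by_cases hx : (bf x : ℂ) = 0
    · change (bf x : ℂ) * (bψ x : ℂ) = (bf x : ℂ)
      simp [hx]
    · change (bf x : ℂ) * (bψ x : ℂ) = (bf x : ℂ)
      rw [hone x (hfball x hx), mul_one]
  · intro k x
    by_cases hx : (bf x : ℂ) = 0
    · exact mul_eq_zero_of_left hx _
    · exact mul_eq_zero_of_right _ (iterate_laplacian_eq_zero_of_eqOn_one Metric.isOpen_ball
        (φ := hsψ.toSchwartzMap hcψ) hone k x (hfball x hx))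
  · change ∫ x, (bf x : ℂ) ≠ 0
    rw [integral_complex_ofReal]
    exact_mod_cast (bf.integral_pos).ne'

end Dilation

/-! ### The dyadic potential -/

section Potential

variable {d : ℕ}

local notation "𝔼" => EuclideanSpace ℝ (Fin d)

/-- The dyadic annulus `1 < 2 ^ n * ‖x‖ < 2`. -/
def dyadicAnnulus (d n : ℕ) : Set (EuclideanSpace ℝ (Fin d)) :=
  {x | 1 < 2 ^ n * ‖x‖ ∧ 2 ^ n * ‖x‖ < 2}

theorem isOpen_dyadicAnnulus (n : ℕ) : IsOpen (dyadicAnnulus d n) := by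
  have h : Continuous fun x : 𝔼 ↦ (2 : ℝ) ^ n * ‖x‖ := by fun_prop
  exact (isOpen_Ioo (a := (1 : ℝ)) (b := 2)).preimage h

/-- The absorption coefficient that is equal to `2 ^ (n * κ)` on the dyadic annulus
`2 ^ (-n) ≤ ‖x‖ < 2 ^ (1 - n)`, for `n ≥ 1`. -/
noncomputable def dyadicStrength (κ : ℝ) (x : 𝔼) : ℝ :=
  if ‖x‖ < 1 then (2 : ℝ) ^ (-(⌊Real.logb 2 ‖x‖⌋ : ℝ) * κ) else 0

/-- The imaginary potential with the coefficient `dyadicStrength`. -/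
noncomputable def dyadicPotential (κ : ℝ) (x : 𝔼) : ℂ :=
  -(Complex.I * (dyadicStrength κ x : ℂ))

theorem dyadicPotential_eq {κ : ℝ} {n : ℕ} (hn : 1 ≤ n) {x : 𝔼} (hx : x ∈ dyadicAnnulus d n) :
    dyadicPotential κ x = -(Complex.I * (((2 : ℝ) ^ n) ^ κ : ℝ)) := by
  obtain ⟨h1, h2⟩ := hx
  have hpos : (0 : ℝ) < 2 ^ n := by positivity
  have hx0 : 0 < ‖x‖ := pos_of_mul_pos_right (zero_lt_one.trans h1) hpos.le
  have hx1 : ‖x‖ < 1 := by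
    have : (2 : ℝ) ^ 1 ≤ 2 ^ n := pow_le_pow_right₀ one_le_two hn
    nlinarith
  have hfl : ⌊Real.logb 2 ‖x‖⌋ = -(n : ℤ) := by
    have e : Real.logb 2 (2 ^ n * ‖x‖) = n + Real.logb 2 ‖x‖ := by
      rw [Real.logb_mul hpos.ne' hx0.ne', Real.logb_pow, Real.logb_self_eq_one one_lt_two, mul_one]
    have l1 : 0 < Real.logb 2 (2 ^ n * ‖x‖) := Real.logb_pos one_lt_two h1
    have l2 : Real.logb 2 (2 ^ n * ‖x‖) < 1 := by
      rw [Real.logb_lt_iff_lt_rpow one_lt_two (by linarith)]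
      simpa using h2
    rw [Int.floor_eq_iff]
    push_cast
    constructor <;> linarith
  rw [dyadicPotential, dyadicStrength, if_pos hx1, hfl]
  congr 3
  rw [Int.cast_neg, neg_neg, Int.cast_natCast, Real.rpow_mul zero_le_two, Real.rpow_natCast]

theorem measurable_dyadicStrength (κ : ℝ) : Measurable (dyadicStrength κ : 𝔼 → ℝ) := by
  refine Measurable.ite (measurableSet_lt measurable_norm measurable_const) ?_ measurable_const
  have h : Measurable fun x : 𝔼 ↦ (⌊Real.logb 2 ‖x‖⌋ : ℤ) :=
    Int.measurable_floor.comp ((Real.measurable_log.div_const _).comp measurable_norm)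
  exact (measurable_from_top (f := fun k : ℤ ↦ (2 : ℝ) ^ (-(k : ℝ) * κ))).comp h

theorem dyadicStrength_nonneg (κ : ℝ) (x : 𝔼) : 0 ≤ dyadicStrength κ x := by
  unfold dyadicStrength
  split_ifs <;> positivity

/-- The origin is excluded: there the strength takes the default value `1`, while `0 ^ (-κ) = 0` for
`κ > 0`. -/
theorem dyadicStrength_le {κ : ℝ} (hκ : 0 ≤ κ) {x : 𝔼} (hx : x ≠ 0) :
    dyadicStrength κ x ≤ 2 ^ κ * ‖x‖ ^ (-κ) := by
  have hx0 : 0 < ‖x‖ := norm_pos_iff.2 hx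
  unfold dyadicStrength
  split_ifs
  · have h : (2 : ℝ) ^ (-(⌊Real.logb 2 ‖x‖⌋ : ℝ)) ≤ 2 * ‖x‖⁻¹ := by
      calc (2 : ℝ) ^ (-(⌊Real.logb 2 ‖x‖⌋ : ℝ)) ≤ 2 ^ (1 + -Real.logb 2 ‖x‖) := by
            apply Real.rpow_le_rpow_of_exponent_le one_le_two
            linarith [Int.lt_floor_add_one (Real.logb 2 ‖x‖)]
        _ = 2 * ‖x‖⁻¹ := by
          rw [Real.rpow_add two_pos, Real.rpow_one, Real.rpow_neg zero_le_two,
            Real.rpow_logb two_pos (by norm_num) hx0]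
    rw [Real.rpow_mul zero_le_two]
    refine (Real.rpow_le_rpow (by positivity) h hκ).trans_eq ?_
    rw [Real.mul_rpow zero_le_two (by positivity), Real.inv_rpow hx0.le, Real.rpow_neg hx0.le]
  · positivity

theorem memLp_dyadicPotential {κ r : ℝ} (hd : 1 ≤ d) (hκ : 0 ≤ κ) (hr : 0 < r) (h : κ * r < d) :
    MemLp (dyadicPotential κ : 𝔼 → ℂ) (ENNReal.ofReal r) volume := by
  have : Nonempty (Fin d) := ⟨⟨0, hd⟩⟩
  have hmeas : Measurable (dyadicPotential κ : 𝔼 → ℂ) :=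
    ((Complex.measurable_ofReal.comp (measurable_dyadicStrength κ)).const_mul Complex.I).neg
  have hnorm (x : 𝔼) : ‖dyadicPotential κ x‖ = dyadicStrength κ x := by
    simp [dyadicPotential, abs_of_nonneg (dyadicStrength_nonneg κ x)]
  rw [← integrable_norm_rpow_iff hmeas.aestronglyMeasurable (by simpa using hr) ENNReal.ofReal_ne_top,
    ENNReal.toReal_ofReal hr.le]
  simp_rw [hnorm]
  have hm : Measurable fun x : 𝔼 ↦ dyadicStrength κ x ^ r :=
    (measurable_dyadicStrength κ).pow_const r
  refine (integrableOn_iff_integrable_of_support_subset (s := Metric.ball 0 1) ?_).1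
    (integrableOn_ball_of_norm_le_rpow (C := (2 ^ κ) ^ r) (α := κ * r) (by simpa using hd)
      (by simpa using h) (ae_restrict_of_ae ?_) hm.aestronglyMeasurable)
  · intro x hx
    by_contra hx1
    have : ¬ ‖x‖ < 1 := by simpa using hx1
    exact hx (by simp [dyadicStrength, this, hr.ne'])
  · filter_upwards [compl_mem_ae_iff.2 (measure_singleton (0 : 𝔼))] with x hx
    have hx0 : x ≠ 0 := hx
    rw [Real.norm_of_nonneg (Real.rpow_nonneg (dyadicStrength_nonneg κ x) r)]
    refine (Real.rpow_le_rpow (dyadicStrength_nonneg κ x) (dyadicStrength_le hκ hx0) hr.le).trans_eq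
      ?_
    rw [Real.mul_rpow (by positivity) (by positivity), ← Real.rpow_mul (norm_nonneg x), neg_mul]

end Potential

/-! ### Norm inflation and superposition of scales -/

section Inflation

variable {d : ℕ}

local notation "𝔼" => EuclideanSpace ℝ (Fin d)

theorem tendsto_inflation_bound {δ : ℝ} (hδ : 0 < δ) (C A B s : ℝ) {q : ℝ} (hq : s < q) :
    Tendsto (fun L : ℝ ↦ C * (Real.exp (-(L ^ δ)) * A + L ^ (-q) * B) * L ^ s) atTop (𝓝 0) := by
  have h1 : Tendsto (fun L : ℝ ↦ (L ^ δ) ^ (s / δ) * Real.exp (-1 * (L ^ δ))) atTop (𝓝 0) :=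
    (tendsto_rpow_mul_exp_neg_mul_atTop_nhds_zero (s / δ) 1 one_pos).comp (tendsto_rpow_atTop hδ)
  have h2 : Tendsto (fun L : ℝ ↦ L ^ (-(q - s))) atTop (𝓝 0) :=
    tendsto_rpow_neg_atTop (sub_pos.2 hq)
  have h3 := ((h1.mul_const A).add (h2.mul_const B)).const_mul C
  simp only [zero_mul, add_zero, mul_zero] at h3
  refine h3.congr' ?_
  filter_upwards [eventually_gt_atTop 0] with L hL
  rw [← Real.rpow_mul hL.le, mul_div_cancel₀ _ hδ.ne', neg_sub, sub_eq_neg_add,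
    Real.rpow_add hL, neg_one_mul]
  ring

theorem hasCompactSupport_dilation (n : ℕ) {ψ : 𝓢(𝔼, ℂ)} (h : HasCompactSupport ψ) :
    HasCompactSupport (dilation n ψ) :=
  h.comp_homeomorph
    (ContinuousLinearEquiv.smulLeft (Units.mk0 ((2 : ℝ) ^ n) (by positivity)) :
      𝔼 ≃L[ℝ] 𝔼).toHomeomorph

theorem tsupport_dilation_subset (n : ℕ) {ψ : 𝓢(𝔼, ℂ)}
    (h : ∀ x ∈ tsupport ψ, 1 < ‖x‖ ∧ ‖x‖ < 2) : tsupport (dilation n ψ) ⊆ dyadicAnnulus d n := by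
  intro x hx
  have h1 : (2 : ℝ) ^ n • x ∈ tsupport ψ :=
    tsupport_comp_subset_preimage (f := fun y : 𝔼 ↦ (2 : ℝ) ^ n • y) ψ (by fun_prop) hx
  simpa [dyadicAnnulus, norm_smul] using h _ h1

/-- The threshold for `n` is uniform over data and solutions. The hypotheses ask that the datum be
at least of size `L ^ (-p)` against the dilated bump, with `L = 2 ^ n`, and have no higher moments.
-/
theorem eventually_sobolevNorm_large {κ γ : ℝ} (hκ : 2 < κ) {ψ : 𝓢(𝔼, ℂ)}
    (hψ : HasCompactSupport ψ) (hψU : ∀ x ∈ tsupport ψ, 1 < ‖x‖ ∧ ‖x‖ < 2) {p : ℕ} {b : ℝ}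
    (hb : 0 < b) {T : ℝ≥0∞} (hT : 0 < T) {C : ℝ} (hC : 0 ≤ C) :
    ∀ᶠ n : ℕ in atTop, ∀ (u₀ : 𝓢'(𝔼, ℂ)) (u : ℝ → 𝓢'(𝔼, ℂ)),
      IsStrongSolution (dyadicPotential κ) γ T u₀ u →
      b ≤ ‖u₀ (dilation n ψ)‖ * ((2 : ℝ) ^ n) ^ p →
      (∀ k, u₀ (Δ^[k + 1] (dilation n ψ)) = 0) →
      ∃ t ∈ timeInterval T, ENNReal.ofReal C < sobolevNorm γ (u t) := by
  obtain ⟨M, hM⟩ := exists_norm_dilation_le (dualSobolevLp γ : 𝓢(𝔼, ℂ) →L[ℂ] _)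
  set δ : ℝ := (κ - 2) / 2 with hδdef
  have hδ : 0 < δ := by rw [hδdef]; linarith
  -- With this many integrations the gain `L ^ (-(δ * K))` beats both the duality loss `L ^ M` and
  -- the smallness `L ^ (-p)` of the datum.
  obtain ⟨K, hK⟩ := exists_nat_gt ((M + p : ℝ) / δ)
  have hKpos : 0 < K := by
    have : (0 : ℝ) < K := lt_of_le_of_lt (by positivity) hK
    exact_mod_cast this
  have hq : (M + p : ℝ) < δ * K := by rwa [div_lt_iff₀' hδ] at hK
  obtain ⟨A, hA0, hA⟩ := hM ψ
  obtain ⟨B, hB0, hB⟩ := hM (Δ^[K] ψ)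
  have hL : Tendsto (fun n : ℕ ↦ (2 : ℝ) ^ n) atTop atTop :=
    tendsto_pow_atTop_atTop_of_one_lt one_lt_two
  have hτ : Tendsto (fun L : ℝ ↦ ENNReal.ofReal (L ^ (-((κ + 2) / 2)))) atTop (𝓝 0) := by
    rw [← ENNReal.ofReal_zero]
    exact ENNReal.tendsto_ofReal (tendsto_rpow_neg_atTop (by linarith))
  filter_upwards [eventually_ge_atTop 1, (hτ.comp hL).eventually_lt_const hT,
    ((tendsto_inflation_bound hδ C A B (M + p) hq).comp hL).eventually_lt_const hb]
    with n hn hnT hnb u₀ u hu hlow hz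
  simp only [Function.comp_apply] at hnT hnb
  by_contra! hle
  set L : ℝ := 2 ^ n with hLdef
  have hLpos : 0 < L := by positivity
  -- The geometric mean of the amplification time `L ^ (-κ)` and the dispersion time `L ^ (-2)`:
  -- then `a τ = L ^ δ` is large and `τ L ^ 2 = L ^ (-δ)` is small.
  set τ : ℝ := L ^ (-((κ + 2) / 2)) with hτdef
  have hτ0 : 0 ≤ τ := by positivity
  have hτT : τ ∈ timeInterval T := ⟨hτ0, hnT⟩
  have main := hu.norm_initial_apply_le (isOpen_dyadicAnnulus n) (a := L ^ κ) (by positivity)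
    (fun x hx ↦ dyadicPotential_eq hn hx) (hasCompactSupport_dilation n hψ)
    (tsupport_dilation_subset n hψU) hτT hC
    (fun t ht ↦ hle t ⟨ht.1, (ENNReal.ofReal_le_ofReal ht.2).trans_lt hnT⟩) hKpos
    (fun k hk _ ↦ by obtain ⟨j, rfl⟩ := Nat.exists_eq_add_of_le' hk; exact hz j)
  have e1 : L ^ κ * τ = L ^ δ := by
    rw [hτdef, ← Real.rpow_add hLpos]
    congr 1
    rw [hδdef]; ring
  have e2 : τ ^ K * (L ^ 2) ^ K = L ^ (-(δ * K)) := by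
    rw [← mul_pow, hτdef, ← Real.rpow_natCast L 2, ← Real.rpow_add hLpos, ← Real.rpow_mul_natCast
      hLpos.le]
    congr 1
    rw [hδdef]; push_cast; ring
  have e3 : ‖dualSobolevLp γ (Δ^[K] (dilation n ψ))‖ ≤ (L ^ 2) ^ K * (B * L ^ M) := by
    rw [iterate_laplacian_dilation, map_smul, norm_smul]
    have : ‖((4 : ℂ) ^ n) ^ K‖ = (L ^ 2) ^ K := by
      rw [norm_pow, norm_pow, hLdef, ← pow_mul 2 n 2, mul_comm n 2, pow_mul]
      norm_num
    rw [this]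
    gcongr
    exact hB n
  rw [e1] at main
  have h1 : ‖u₀ (dilation n ψ)‖ ≤ C * (Real.exp (-(L ^ δ)) * A + L ^ (-(δ * K)) * B) * L ^ M := by
    refine main.trans ?_
    rw [mul_assoc, add_mul, mul_assoc, mul_assoc, ← e2, mul_assoc (τ ^ K)]
    gcongr
    exact hA n
  have h2 : L ^ (M + p : ℝ) = L ^ M * L ^ p := by
    rw [Real.rpow_add hLpos, Real.rpow_natCast, Real.rpow_natCast]
  rw [h2, ← mul_assoc] at hnb
  have h3 : ‖u₀ (dilation n ψ)‖ * L ^ p ≤ _ := mul_le_mul_of_nonneg_right h1 (by positivity)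
  linarith

theorem IsStrongSolution.mono {η : 𝔼 → ℂ} {γ : ℝ} {T T' : ℝ≥0∞} {u₀ : 𝓢'(𝔼, ℂ)}
    {u : ℝ → 𝓢'(𝔼, ℂ)} (hu : IsStrongSolution η γ T u₀ u) (hT : T' ≤ T) :
    IsStrongSolution η γ T' u₀ u := by
  have hsub : timeInterval T' ⊆ timeInterval T := fun t ht ↦ ⟨ht.1, ht.2.trans_le hT⟩
  refine ⟨hu.initial, fun t ht ↦ hu.memSobolev t (hsub ht),
    fun t ht ↦ (hu.continuous t (hsub ht)).mono_left (nhdsWithin_mono t hsub), ?_⟩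
  obtain ⟨w, hw, h⟩ := hu.equation
  exact ⟨w, ae_restrict_of_ae_restrict_of_subset hsub hw, fun φ t ht ↦ h φ t (hsub ht)⟩

/-- A strong solution is bounded on a short time interval. -/
theorem IsStrongSolution.exists_bounded {η : 𝔼 → ℂ} {γ : ℝ} {T : ℝ≥0∞} {u₀ : 𝓢'(𝔼, ℂ)}
    {u : ℝ → 𝓢'(𝔼, ℂ)} (hT : 0 < T) (hu : IsStrongSolution η γ T u₀ u) :
    ∃ T' C, 0 < T' ∧ T' ≤ T ∧ 0 ≤ C ∧
      ∀ t ∈ timeInterval T', sobolevNorm γ (u t) ≤ ENNReal.ofReal C := by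
  have h0 : (0 : ℝ) ∈ timeInterval T := ⟨le_rfl, by simpa using hT⟩
  have hev := (hu.continuous 0 h0).eventually_le_const (zero_lt_one (α := ℝ≥0∞))
  obtain ⟨ε, hε, hball⟩ := Metric.mem_nhdsWithin_iff.1 hev
  refine ⟨min (ENNReal.ofReal ε) T, (1 + sobolevNorm γ (u 0)).toReal,
    lt_min (ENNReal.ofReal_pos.2 hε) hT, min_le_right _ _, ENNReal.toReal_nonneg, fun t ht ↦ ?_⟩
  rw [ENNReal.ofReal_toReal
    (ENNReal.add_ne_top.2 ⟨ENNReal.one_ne_top, (sobolevNorm_lt_top (hu.memSobolev 0 h0)).ne⟩)]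
  have htε : t < ε := (ENNReal.ofReal_lt_ofReal_iff hε).1 (ht.2.trans_le (min_le_left _ _))
  have hmem : t ∈ Metric.ball 0 ε ∩ timeInterval T :=
    ⟨by simpa [abs_of_nonneg ht.1] using htε, ht.1, ht.2.trans_le (min_le_right _ _)⟩
  have h1 : sobolevNorm γ (u t - u 0) ≤ 1 := hball hmem
  calc sobolevNorm γ (u t) = sobolevNorm γ ((u t - u 0) + u 0) := by rw [sub_add_cancel]
    _ ≤ sobolevNorm γ (u t - u 0) + sobolevNorm γ (u 0) := sobolevNorm_add_le _ _ _
    _ ≤ _ := by gcongr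

theorem dilation_mul_dilation_eq_zero {f φ : 𝓢(𝔼, ℂ)} (hf : ∀ x, f x ≠ 0 → 1 < ‖x‖ ∧ ‖x‖ < 2)
    (hφ : ∀ x, φ x ≠ 0 → 1 < ‖x‖ ∧ ‖x‖ < 2) {m n : ℕ} (hmn : m ≠ n) (x : 𝔼) :
    dilation m f x * dilation n φ x = 0 := by
  by_contra h
  obtain ⟨h1, h2⟩ := mul_ne_zero_iff.1 h
  rw [dilation_apply] at h1 h2
  have a := hf _ h1
  have b := hφ _ h2
  simp only [norm_smul, norm_pow, Real.norm_ofNat] at a b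
  rcases lt_or_gt_of_ne hmn with h | h
  · have hp : (2 : ℝ) ^ m * 2 ≤ 2 ^ n := by
      rw [← pow_succ]; exact pow_le_pow_right₀ one_le_two h
    nlinarith [norm_nonneg x]
  · have hp : (2 : ℝ) ^ n * 2 ≤ 2 ^ m := by
      rw [← pow_succ]; exact pow_le_pow_right₀ one_le_two h
    nlinarith [norm_nonneg x]

/-- Summation takes place in `L²` after the Bessel potential; the inverse potential and evaluation
at `φ` are continuous and linear. Moments of the superposed datum can thus be computed scale by
scale. -/
theorem hasSum_apply_besselPotential {γ : ℝ} {F : ℕ → 𝓢(𝔼, ℂ)} {g : Lp ℂ 2 (volume : Measure 𝔼)}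
    (h : HasSum (fun m ↦ schwartzSobolevLp γ (F m)) g) (φ : 𝓢(𝔼, ℂ)) :
    HasSum (fun m ↦ (F m : 𝓢'(𝔼, ℂ)) φ) (besselPotential 𝔼 ℂ (-γ) (g : 𝓢'(𝔼, ℂ)) φ) := by
  have hF (m : ℕ) : (F m : 𝓢'(𝔼, ℂ)) φ =
      besselPotential 𝔼 ℂ (-γ) (schwartzSobolevLp γ (F m) : 𝓢'(𝔼, ℂ)) φ := by
    rw [← besselPotential_coe_schwartz, besselPotential_besselPotential_apply]
    simp
  simp_rw [hF]
  exact ((PointwiseConvergenceCLM.evalCLM (RingHom.id ℂ) ℂ φ) ∘L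
    (besselPotential 𝔼 ℂ (-γ)) ∘L (Lp.toTemperedDistributionCLM ℂ volume 2)).hasSum h

end Inflation

theorem theorem1p2 (d : ℕ) (hd : 3 ≤ d) (r : ℝ) (hr : 1 ≤ r) (hrd : r < (d : ℝ) / 2) :
    ∃ η : EuclideanSpace ℝ (Fin d) → ℂ, MemLrAddLinfty r η ∧
      ∀ γ : ℝ, IllPosed η γ ∧ DiscontinuousAtZero η γ := by
  have hr0 : 0 < r := by linarith
  obtain ⟨κ, hκ, hκd⟩ := exists_between (show 2 < (d : ℝ) / r by rw [lt_div_iff₀ hr0]; linarith)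
  rw [lt_div_iff₀ hr0] at hκd
  refine ⟨dyadicPotential κ, ⟨dyadicPotential κ, 0,
    memLp_dyadicPotential (by omega) (by linarith) hr0 hκd, MemLp.zero, by simp⟩, fun γ ↦ ?_⟩
  obtain ⟨f, ψ, hf, hψ, hψU, hfψ, hfΔ, hint⟩ := exists_bump_pair (d := d) (by omega)
  obtain ⟨M, hM⟩ := exists_norm_dilation_le
    (schwartzSobolevLp γ : 𝓢(EuclideanSpace ℝ (Fin d), ℂ) →L[ℂ] _)
  obtain ⟨A, hA0, hA⟩ := hM f
  -- The power `M` cancels the growth of the `H^γ` norm of the dilated bump, and one more power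
  -- makes the norms summable.
  set c : ℕ → ℂ := fun n ↦ (((2 : ℂ) ^ n) ^ (M + 1))⁻¹ with hc
  set F : ℕ → 𝓢(EuclideanSpace ℝ (Fin d), ℂ) := fun n ↦ c n • dilation n f with hF
  have hFnorm (n : ℕ) : ‖schwartzSobolevLp γ (F n)‖ ≤ A * (1 / 2) ^ n := by
    have hcn : ‖c n‖ = (((2 : ℝ) ^ n) ^ (M + 1))⁻¹ := by simp [hc]
    rw [hF, map_smul, norm_smul, hcn, one_div, inv_pow]
    calc _ ≤ (((2 : ℝ) ^ n) ^ (M + 1))⁻¹ * (A * ((2 : ℝ) ^ n) ^ M) := by gcongr; exact hA n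
      _ = A * ((2 : ℝ) ^ n)⁻¹ := by rw [pow_succ]; field_simp
  have hpair (m n k : ℕ) : (F m : 𝓢'(EuclideanSpace ℝ (Fin d), ℂ)) (Δ^[k] (dilation n ψ)) =
      (4 ^ n) ^ k * (c m * ∫ x, dilation m f x * dilation n (Δ^[k] ψ) x) := by
    rw [SchwartzMap.coe_apply, iterate_laplacian_dilation, ← integral_const_mul,
      ← integral_const_mul]
    refine integral_congr_ae (Eventually.of_forall fun x ↦ ?_)
    simp only [hF, smul_apply, smul_eq_mul]
    ring
  have hpair_ne (m n k : ℕ) (hmn : m ≠ n) :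
      (F m : 𝓢'(EuclideanSpace ℝ (Fin d), ℂ)) (Δ^[k] (dilation n ψ)) = 0 := by
    have hφ (x : EuclideanSpace ℝ (Fin d)) (hx : (Δ^[k] ψ) x ≠ 0) : 1 < ‖x‖ ∧ ‖x‖ < 2 :=
      hψU x (tsupport_iterate_laplacian_subset k ψ (subset_closure hx))
    rw [hpair]
    simp [dilation_mul_dilation_eq_zero hf hφ hmn]
  have hpair_succ (n k : ℕ) :
      (F n : 𝓢'(EuclideanSpace ℝ (Fin d), ℂ)) (Δ^[k + 1] (dilation n ψ)) = 0 := by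
    rw [hpair]
    simp [dilation_apply, hfΔ, -Function.iterate_succ]
  have hpair_zero (n : ℕ) : (F n : 𝓢'(EuclideanSpace ℝ (Fin d), ℂ)) (dilation n ψ) =
      c n * ((((2 : ℂ) ^ n) ^ d)⁻¹ * ∫ x, f x) := by
    have := hpair n n 0
    rw [Function.iterate_zero_apply, Function.iterate_zero_apply, pow_zero, one_mul] at this
    rw [this, ← integral_dilation]
    simp only [dilation_apply, hfψ]
  have hb : 0 < ‖∫ x, f x‖ := norm_pos_iff.2 hint
  -- The exponent collects `M + 1` from `c n` and `d` from the Jacobian of the dilation; for this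
  -- exponent equality holds.
  have hlow (n : ℕ) {u₀ : 𝓢'(EuclideanSpace ℝ (Fin d), ℂ)}
      (h : u₀ (dilation n ψ) = (F n : 𝓢'(EuclideanSpace ℝ (Fin d), ℂ)) (dilation n ψ)) :
      ‖∫ x, f x‖ ≤ ‖u₀ (dilation n ψ)‖ * ((2 : ℝ) ^ n) ^ (M + 1 + d) := by
    rw [h, hpair_zero]
    simp only [hc, norm_mul, norm_inv, norm_pow, Complex.norm_ofNat]
    apply le_of_eq
    rw [pow_add _ (M + 1) d]
    field_simp
  constructor
  -- Existence alone is refuted. A solution from the superposed datum would be bounded on a short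
  -- interval, yet its moments at each scale `n` agree with those of `F n`, since distinct dyadic
  -- annuli are disjoint, and this forces inflation.
  · rintro ⟨X, Tmax, Φ, hex, -, -⟩
    have hsum : Summable fun m ↦ schwartzSobolevLp γ (F m) :=
      Summable.of_norm_bounded ((summable_geometric_two).mul_left A) hFnorm
    obtain ⟨g, hg⟩ := hsum
    have happ (n k : ℕ) : besselPotential _ ℂ (-γ) (g : 𝓢'(EuclideanSpace ℝ (Fin d), ℂ))
        (Δ^[k] (dilation n ψ)) =
          (F n : 𝓢'(EuclideanSpace ℝ (Fin d), ℂ)) (Δ^[k] (dilation n ψ)) :=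
      (hasSum_apply_besselPotential hg _).unique
        (hasSum_single n fun m hm ↦ hpair_ne m n k hm)
    obtain ⟨hT, hu, -⟩ := hex (besselPotential _ ℂ (-γ) (g : 𝓢'(EuclideanSpace ℝ (Fin d), ℂ)))
      ⟨g, by simp [besselPotential_besselPotential_apply]⟩
    obtain ⟨T', C, hT', hle, hC, hbound⟩ := hu.exists_bounded hT
    obtain ⟨n, hn⟩ := (eventually_sobolevNorm_large (γ := γ) hκ hψ hψU (p := M + 1 + d) hb hT'
      hC).exists
    obtain ⟨t, ht, hlt⟩ := hn _ _ (hu.mono hle) (hlow n (happ n 0))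
      fun k ↦ (happ n (k + 1)).trans (hpair_succ n k)
    exact (hbound t ht).not_gt hlt
  · refine ⟨F, ?_, fun T hT C hC ↦ ?_⟩
    · have h0 : Tendsto (fun n : ℕ ↦ ENNReal.ofReal (A * (1 / 2) ^ n)) atTop (𝓝 0) := by
        rw [← ENNReal.ofReal_zero, ← mul_zero A]
        exact ENNReal.tendsto_ofReal
          ((tendsto_pow_atTop_nhds_zero_of_lt_one (by norm_num) (by norm_num)).const_mul A)
      refine tendsto_of_tendsto_of_tendsto_of_le_of_le tendsto_const_nhds h0 (fun _ ↦ zero_le)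
        fun n ↦ ?_
      refine (sobolevNorm_le_of_eq (besselPotential_coe_schwartz γ (F n))).trans ?_
      rw [← ofReal_norm]
      exact ENNReal.ofReal_le_ofReal (hFnorm n)
    · filter_upwards [eventually_sobolevNorm_large (γ := γ) hκ hψ hψU (p := M + 1 + d) hb hT
        (C := C.toReal) ENNReal.toReal_nonneg] with n hn u hu
      have := hn _ u hu (hlow n rfl) (hpair_succ n)
      rwa [ENNReal.ofReal_toReal hC.ne] at this
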